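/- \textbf{Setting.} Let $\mathcal G=(\mathcal V,\mathcal E)$ be a connected simple graph whose buses are $N_G\ge 1$ generators $1,\dots,N_G$ and, disjoint from them, $N_L$ loads $N_G+1,\dots,N_G+N_L$; the branches are labelled $1,\dots,E$ and branch $e$ has susceptance $b_e>0$. Let $\mathbf C$ be a signed incidence matrix and $\mathbf B=\mathrm{diag}(b_1,\dots,b_E)$. Let limits $\xi=(\overline{\mathbf s}^g,\underline{\mathbf s}^g,\overline{\mathbf p},\underline{\mathbf p})$ with $\overline{\mathbf s}^g>\underline{\mathbf s}^g\ge 0$ and $\overline{\mathbf p}>\underline{\mathbf p}$ (entrywise) and a cost vector $\mathbf f\in\mathbb R^{N_G}$ be given. For a load vector $\mathbf s^l\in\mathbb R^{N_L}$ the DC optimal power flow problem is $$\min_{\mathbf s^g,\theta}\ \mathbf f^{\mathsf T}\mathbf s^g\quad\text{s.t.}\quad \theta_1=0,\quad \mathbf C\mathbf B\mathbf C^{\mathsf T}\theta=\begin{bmatrix}\mathbf s^g\\-\mathbf s^l\end{bmatrix},\quad \underline{\mathbf s}^g\le\mathbf s^g\le\overline{\mathbf s}^g,\quad \underline{\mathbf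 p}\le\mathbf B\mathbf C^{\mathsf T}\theta\le\overline{\mathbf p}.$$ Let $\Omega_{s^l}$ be the set of $\mathbf s^l>0$ (entrywise) for which the constraints are feasible, and assume that it is nonempty. Assume that for every $\mathbf s^l\in\Omega_{s^l}$ the problem has a unique optimal solution and every family of Lagrange multipliers satisfying its KKT conditions has at least $N_G-1$ nonzero entries among the multipliers of the inequality constraints. Write $\mathcal{OPF}(\mathbf s^l)\in\mathbb R^{N_G}$ for the optimal $\mathbf s^g$. Let $S_G(\mathbf s^l)$ be the set of generators $i$ with $\mathbf s^g_i\in\{\underline{\mathbf s}^g_i,\overline{\mathbf s}^g_i\}$ at the optimum, and $S_B(\mathbf s^l)$ the set of branches $e$ whose optimal flow $\mathbf p_e=(\mathbf B\mathbf C^{\mathsf T}\theta)_e$ lies in $\{\underline{\mathbf p}_e,\overline{\mathbf p}_e\}$. Let $\widetilde\Omega_{s^l}\subseteq\Omega_{s^l}$ be the set of loads at whose optimum exactly $N_G-1$ inequality constraints are binding. \textbf{Theorem.} Let $\mathbf s^l\in\widetilde\Omega_{s^l}$ be such that every branch in $S_B(\mathbf s^l)$ is a bridge of $\mathcal G$ (its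 removal disconnects $\mathcal G$). Then: \begin{enumerate} \item $\mathcal{OPF}$ is differentiable at $\mathbf s^l$ and $\partial\mathcal{OPF}_v/\partial \mathbf s^l_u\,(\mathbf s^l)\ge 0$ for all generators $v$ and loads $u$. \item The system is locally monotone: there is a neighbourhood $U\subseteq\Omega_{s^l}$ of $\mathbf s^l$ such that $\mathcal{OPF}(\alpha)\ge\mathcal{OPF}(\beta)$ entrywise for all $\alpha,\beta\in U$ with $\alpha\ge\beta$ entrywise. \item Each connected component of the graph obtained from $\mathcal G$ by deleting the branches in $S_B(\mathbf s^l)$ contains exactly one generator outside $S_G(\mathbf s^l)$. \item $\partial\mathcal{OPF}_v/\partial \mathbf s^l_u\,(\mathbf s^l)$ equals $1$ if $v\notin S_G(\mathbf s^l)$ and $v$ lies in the same component of that graph as load $u$, and equals $0$ otherwise. \end{enumerate} -/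

import Mathlib

/-- The set of buses: `Sum.inl i` is generator `i`, `Sum.inr j` is load `j`. -/
abbrev Bus (NG NL : ℕ) : Type := Fin NG ⊕ Fin NL

/-- A connected power network with `NG` generators, `NL` loads and `NE` labelled branches.
Every branch carries an (arbitrary) orientation from `tail` to `head`, used only for the signs
in the incidence matrix, and a positive susceptance. -/
structure DCNetwork (NG NL NE : ℕ) where
  graph : SimpleGraph (Bus NG NL)
  connected : graph.Connected
  edge : Fin NE ≃ graph.edgeSet
  tail : Fin NE → Bus NG NL
  head : Fin NE → Bus NG NL
  edge_eq : ∀ e, (edge e : Sym2 (Bus NG NL)) = s(tail e, head e)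
  b : Fin NE → ℝ
  b_pos : ∀ e, 0 < b e

/-- The vector of system limits for generations and branch flows (well posed: every upper limit
exceeds the lower one). -/
structure Limits (NG NE : ℕ) where
  sgUp : Fin NG → ℝ
  sgLo : Fin NG → ℝ
  pUp : Fin NE → ℝ
  pLo : Fin NE → ℝ
  sgLo_lt_sgUp : ∀ i, sgLo i < sgUp i
  pLo_lt_pUp : ∀ e, pLo e < pUp e

namespace DCNetwork

/-- The signed incidence matrix. -/
def C {NG NL NE : ℕ} (N : DCNetwork NG NL NE) : Matrix (Bus NG NL) (Fin NE) ℝ :=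
  Matrix.of fun v e => if v = N.tail e then 1 else if v = N.head e then -1 else 0

/-- The diagonal matrix of susceptances. -/
def B {NG NL NE : ℕ} (N : DCNetwork NG NL NE) : Matrix (Fin NE) (Fin NE) ℝ :=
  Matrix.diagonal N.b

/-- Branch power flows as a function of the voltage angles. -/
def flow {NG NL NE : ℕ} (N : DCNetwork NG NL NE) (θ : Bus NG NL → ℝ) : Fin NE → ℝ :=
  Matrix.mulVec (N.B * N.C.transpose) θ

/-- The slack bus, i.e. the first generator. -/
def slack {NG NL NE : ℕ} [NeZero NG] (_N : DCNetwork NG NL NE) : Bus NG NL := Sum.inl 0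

/-- Feasibility of `(s^g, θ)` for the DC OPF problem with loads `sl`. -/
structure Feasible {NG NL NE : ℕ} [NeZero NG] (N : DCNetwork NG NL NE) (ξ : Limits NG NE)
    (sl : Fin NL → ℝ) (x : (Fin NG → ℝ) × (Bus NG NL → ℝ)) : Prop where
  slack_zero : x.2 N.slack = 0
  balance : Matrix.mulVec (N.C * N.B * N.C.transpose) x.2 = Sum.elim x.1 (-sl)
  sgLo_le : ∀ i, ξ.sgLo i ≤ x.1 i
  le_sgUp : ∀ i, x.1 i ≤ ξ.sgUp i
  pLo_le : ∀ e, ξ.pLo e ≤ N.flow x.2 e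
  le_pUp : ∀ e, N.flow x.2 e ≤ ξ.pUp e

/-- `(s^g, θ)` is an optimal solution of the DC OPF problem with cost vector `f`, loads `sl`. -/
def IsOptimal {NG NL NE : ℕ} [NeZero NG] (N : DCNetwork NG NL NE) (ξ : Limits NG NE)
    (f : Fin NG → ℝ) (sl : Fin NL → ℝ) (x : (Fin NG → ℝ) × (Bus NG NL → ℝ)) : Prop :=
  N.Feasible ξ sl x ∧ ∀ y, N.Feasible ξ sl y → dotProduct f x.1 ≤ dotProduct f y.1

/-- The load vectors `Ω_{s^l}(ξ)`: positive, with feasible OPF constraints. -/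
def OmegaL {NG NL NE : ℕ} [NeZero NG] (N : DCNetwork NG NL NE) (ξ : Limits NG NE) :
    Set (Fin NL → ℝ) :=
  {sl | (∀ j, 0 < sl j) ∧ ∃ x, N.Feasible ξ sl x}

/-- The admissible system limits `Ω`. -/
def Omega {NG NL NE : ℕ} [NeZero NG] (N : DCNetwork NG NL NE) : Set (Limits NG NE) :=
  {ξ | (∀ i, 0 ≤ ξ.sgLo i) ∧ (N.OmegaL ξ).Nonempty}

/-- The matrix `C B Cᵀ` with the row of the slack constraint appended. -/
def M {NG NL NE : ℕ} [NeZero NG] (N : DCNetwork NG NL NE) :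
    Matrix (Bus NG NL ⊕ Unit) (Bus NG NL) ℝ :=
  Matrix.fromRows (N.C * N.B * N.C.transpose) (Matrix.of fun _ => Pi.single N.slack 1)

/-- The KKT conditions of the DC OPF problem: `x = (s^g, θ)` with multipliers `τ` (equality
constraints), `lamP, lamM` (upper and lower generation limits), `muP, muM` (upper and lower
branch flow limits). -/
structure KKT {NG NL NE : ℕ} [NeZero NG] (N : DCNetwork NG NL NE) (ξ : Limits NG NE)
    (f : Fin NG → ℝ) (sl : Fin NL → ℝ) (x : (Fin NG → ℝ) × (Bus NG NL → ℝ))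
    (τ : Bus NG NL ⊕ Unit → ℝ) (muP muM : Fin NE → ℝ) (lamP lamM : Fin NG → ℝ) : Prop where
  feasible : N.Feasible ξ sl x
  stationary_angle :
    Matrix.mulVec N.M.transpose τ + Matrix.mulVec (N.C * N.B) (muP - muM) = 0
  stationary_gen : ∀ i, -f i = -τ (Sum.inl (Sum.inl i)) + lamP i - lamM i
  muP_nonneg : ∀ e, 0 ≤ muP e
  muM_nonneg : ∀ e, 0 ≤ muM e
  lamP_nonneg : ∀ i, 0 ≤ lamP i
  lamM_nonneg : ∀ i, 0 ≤ lamM i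
  muP_slack : dotProduct muP (N.flow x.2 - ξ.pUp) = 0
  muM_slack : dotProduct muM (ξ.pLo - N.flow x.2) = 0
  lamP_slack : dotProduct lamP (x.1 - ξ.sgUp) = 0
  lamM_slack : dotProduct lamM (ξ.sgLo - x.1) = 0

/-- The cost vectors `Ω_f`: for all admissible loads the OPF problem has a unique solution, and
all Lagrange multipliers satisfying the KKT conditions have, in total, at least `NG - 1` nonzero
entries belonging to inequality constraints (`hammingNorm` counts nonzero entries). -/
def OmegaF {NG NL NE : ℕ} [NeZero NG] (N : DCNetwork NG NL NE) (ξ : Limits NG NE) :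
    Set (Fin NG → ℝ) :=
  {f | ∀ sl ∈ N.OmegaL ξ,
    (∃! x, N.IsOptimal ξ f sl x) ∧
    ∀ x τ muP muM lamP lamM, N.KKT ξ f sl x τ muP muM lamP lamM →
      NG - 1 ≤ hammingNorm muP + hammingNorm muM + hammingNorm lamP + hammingNorm lamM}

/-- The set-valued OPF operator: all optimal generation vectors. -/
def OPFSet {NG NL NE : ℕ} [NeZero NG] (N : DCNetwork NG NL NE) (ξ : Limits NG NE)
    (f : Fin NG → ℝ) (sl : Fin NL → ℝ) : Set (Fin NG → ℝ) :=
  {sg | ∃ θ, N.IsOptimal ξ f sl (sg, θ)}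

open Classical in
/-- The optimal solution `(s^g, θ)` for loads `sl` (a junk value if there is none; it is the
unique one when `f ∈ Ω_f` and `sl ∈ Ω_{s^l}`). -/
noncomputable def sol {NG NL NE : ℕ} [NeZero NG] (N : DCNetwork NG NL NE) (ξ : Limits NG NE)
    (f : Fin NG → ℝ) (sl : Fin NL → ℝ) : (Fin NG → ℝ) × (Bus NG NL → ℝ) :=
  if h : ∃ x, N.IsOptimal ξ f sl x then h.choose else 0

/-- The OPF operator as a single-valued function of the loads. -/
noncomputable def OPF {NG NL NE : ℕ} [NeZero NG] (N : DCNetwork NG NL NE) (ξ : Limits NG NE)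
    (f : Fin NG → ℝ) (sl : Fin NL → ℝ) : Fin NG → ℝ :=
  (N.sol ξ f sl).1

/-- On admissible loads, for `f ∈ Ω_f`, the single-valued operator represents the set-valued
one. -/
theorem OPFSet_eq_singleton {NG NL NE : ℕ} [NeZero NG] (N : DCNetwork NG NL NE)
    (ξ : Limits NG NE) (f : Fin NG → ℝ) (hf : f ∈ N.OmegaF ξ) (sl : Fin NL → ℝ)
    (hsl : sl ∈ N.OmegaL ξ) : N.OPFSet ξ f sl = {N.OPF ξ f sl} := by
  have hu := (hf sl hsl).1
  have hs : N.IsOptimal ξ f sl (N.sol ξ f sl) := by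
    unfold sol
    rw [dif_pos hu.exists]
    exact hu.exists.choose_spec
  ext sg
  constructor
  · rintro ⟨θ, h⟩
    exact congrArg Prod.fst (hu.unique h hs)
  · rintro rfl
    exact ⟨(N.sol ξ f sl).2, hs⟩

/-- The optimal branch flows. -/
noncomputable def optFlow {NG NL NE : ℕ} [NeZero NG] (N : DCNetwork NG NL NE)
    (ξ : Limits NG NE) (f : Fin NG → ℝ) (sl : Fin NL → ℝ) : Fin NE → ℝ :=
  N.flow (N.sol ξ f sl).2

/-- The binding generators. -/
def bindingGens {NG NL NE : ℕ} [NeZero NG] (N : DCNetwork NG NL NE) (ξ : Limits NG NE)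
    (f : Fin NG → ℝ) (sl : Fin NL → ℝ) : Set (Fin NG) :=
  {i | N.OPF ξ f sl i = ξ.sgLo i ∨ N.OPF ξ f sl i = ξ.sgUp i}

/-- The binding branches. -/
def bindingBranches {NG NL NE : ℕ} [NeZero NG] (N : DCNetwork NG NL NE) (ξ : Limits NG NE)
    (f : Fin NG → ℝ) (sl : Fin NL → ℝ) : Set (Fin NE) :=
  {e | N.optFlow ξ f sl e = ξ.pLo e ∨ N.optFlow ξ f sl e = ξ.pUp e}

/-- The number of inequality constraints that are binding at the optimal solution. -/
noncomputable def numBinding {NG NL NE : ℕ} [NeZero NG] (N : DCNetwork NG NL NE)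
    (ξ : Limits NG NE) (f : Fin NG → ℝ) (sl : Fin NL → ℝ) : ℕ :=
  {i | N.OPF ξ f sl i = ξ.sgLo i}.ncard + {i | N.OPF ξ f sl i = ξ.sgUp i}.ncard +
    {e | N.optFlow ξ f sl e = ξ.pLo e}.ncard + {e | N.optFlow ξ f sl e = ξ.pUp e}.ncard

/-- The load vectors in `Ω_{s^l}` at which exactly `NG - 1` inequality constraints bind. -/
def OmegaLTilde {NG NL NE : ℕ} [NeZero NG] (N : DCNetwork NG NL NE) (ξ : Limits NG NE)
    (f : Fin NG → ℝ) : Set (Fin NL → ℝ) :=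
  {sl ∈ N.OmegaL ξ | N.numBinding ξ f sl = NG - 1}

/-- The bridges: branches whose removal disconnects the graph. -/
def bridges {NG NL NE : ℕ} (N : DCNetwork NG NL NE) : Set (Fin NE) :=
  {e | ¬ (N.graph.deleteEdges {(N.edge e : Sym2 (Bus NG NL))}).Connected}

/-- The graph obtained by cutting a set of branches. -/
def cut {NG NL NE : ℕ} (N : DCNetwork NG NL NE) (S : Set (Fin NE)) :
    SimpleGraph (Bus NG NL) :=
  N.graph.deleteEdges ((fun e => (N.edge e : Sym2 (Bus NG NL))) '' S)

/-- The matrix of partial derivatives of the OPF operator with respect to the loads. -/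
noncomputable def jacobian {NG NL NE : ℕ} [NeZero NG] (N : DCNetwork NG NL NE)
    (ξ : Limits NG NE) (f : Fin NG → ℝ) (sl : Fin NL → ℝ) : Matrix (Fin NG) (Fin NL) ℝ :=
  Matrix.of fun v u => fderiv ℝ (N.OPF ξ f) sl (Pi.single u 1) v

end DCNetwork

/-! ### Flows, the incidence matrix and net injections -/

namespace DCNetwork

open Filter Topology

variable {NG NL NE : ℕ} (N : DCNetwork NG NL NE)

/-! Fix the binding generators and branches and keep the equality constraints: this is a linear
system in `(s^g, θ)`. A kernel vector could be followed from the optimum in both directions without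
leaving the feasible set, so uniqueness of the optimum makes the system injective
(`bindingSystem_injective`). With exactly `NG - 1` binding constraints it is square, hence solvable
for every right-hand side. Solving for a load change moves the optimum linearly along the same
binding limits, and the first-order condition at the old optimum shows that the moved point is
optimal (`exists_linearMap_isOptimal`). Thus the OPF operator is affine near `sl`.

The graph then determines its slope. Solvability puts a free generator in each component of the cut
network, since otherwise an injection there could not be balanced. Cutting `k` bridges leaves at
least `k + 1` components, while `k` binding branches leave exactly `k + 1` free generators, so each
component has exactly one. No change of flow crosses a cut branch, so that generator absorbs
precisely the load changes of its own component: the derivative has entries 0 and 1. -/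

theorem flow_add (θ η : Bus NG NL → ℝ) : N.flow (θ + η) = N.flow θ + N.flow η :=
  Matrix.mulVec_add _ _ _

theorem flow_smul (t : ℝ) (θ : Bus NG NL → ℝ) : N.flow (t • θ) = t • N.flow θ :=
  Matrix.mulVec_smul _ _ _

theorem flow_sub (θ η : Bus NG NL → ℝ) : N.flow (θ - η) = N.flow θ - N.flow η :=
  Matrix.mulVec_sub _ _ _

theorem flow_neg (θ : Bus NG NL → ℝ) : N.flow (-θ) = -N.flow θ :=
  Matrix.mulVec_neg _ _

theorem continuous_flow : Continuous N.flow := by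
  unfold flow
  fun_prop

theorem tail_ne_head (e : Fin NE) : N.tail e ≠ N.head e := by
  intro h
  have h1 := (N.edge e).2
  rw [N.edge_eq, SimpleGraph.mem_edgeSet] at h1
  exact h1.ne h

theorem edge_val_injective :
    Function.Injective fun e => (N.edge e : Sym2 (Bus NG NL)) :=
  Subtype.val_injective.comp N.edge.injective

/-- Pairing the incidence matrix with a potential. -/
theorem sum_mul_C (χ : Bus NG NL → ℝ) (e : Fin NE) :
    ∑ v, χ v * N.C v e = χ (N.tail e) - χ (N.head e) := by
  have h (v : Bus NG NL) : χ v * N.C v e =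
      (if v = N.tail e then χ v else 0) - (if v = N.head e then χ v else 0) := by
    have := N.tail_ne_head e
    simp only [C, Matrix.of_apply]
    split_ifs <;> simp_all
  simp [h]

/-- If no flow leaves the level sets of `χ`, the `χ`-weighted net injection vanishes. -/
theorem sum_mul_balance_eq_zero (χ : Bus NG NL → ℝ) (θ : Bus NG NL → ℝ)
    (h : ∀ e, N.flow θ e = 0 ∨ χ (N.tail e) = χ (N.head e)) :
    ∑ v, χ v * Matrix.mulVec (N.C * N.B * N.C.transpose) θ v = 0 := by
  -- Summation by parts: after exchanging sums, branch `e` contributes its flow times the drop of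
  -- `χ` along `e`.
  have h1 : Matrix.mulVec (N.C * N.B * N.C.transpose) θ = Matrix.mulVec N.C (N.flow θ) := by
    rw [flow, Matrix.mulVec_mulVec, Matrix.mul_assoc]
  rw [h1]
  simp only [Matrix.mulVec, dotProduct, Finset.mul_sum]
  rw [Finset.sum_comm]
  refine Finset.sum_eq_zero fun e _ => ?_
  simp_rw [← mul_assoc]
  rw [← Finset.sum_mul, N.sum_mul_C]
  rcases h e with h | h
  · rw [h, mul_zero]
  · rw [h, sub_self, zero_mul]

/-! ### Feasible directions and first-order optimality -/

variable [NeZero NG] {N} {ξ : Limits NG NE} {f : Fin NG → ℝ} {sl : Fin NL → ℝ}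

/-- Close to a feasible point only the constraints binding at that point matter. -/
theorem Feasible.eventually {x : (Fin NG → ℝ) × (Bus NG NL → ℝ)} (hx : N.Feasible ξ sl x) :
    ∀ᶠ y in 𝓝 x, ∀ sl' : Fin NL → ℝ, y.2 N.slack = 0 →
      Matrix.mulVec (N.C * N.B * N.C.transpose) y.2 = Sum.elim y.1 (-sl') →
      (∀ i, x.1 i = ξ.sgLo i → ξ.sgLo i ≤ y.1 i) →
      (∀ i, x.1 i = ξ.sgUp i → y.1 i ≤ ξ.sgUp i) →
      (∀ e, N.flow x.2 e = ξ.pLo e → ξ.pLo e ≤ N.flow y.2 e) →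
      (∀ e, N.flow x.2 e = ξ.pUp e → N.flow y.2 e ≤ ξ.pUp e) → N.Feasible ξ sl' y := by
  -- Each limit is either attained at `x` or strict there; strict ones persist nearby by continuity,
  -- and there are finitely many.
  have key {ι : Type} [Finite ι] (g : (Fin NG → ℝ) × (Bus NG NL → ℝ) → ι → ℝ)
      (hg : Continuous g) (lo up : ι → ℝ) (h1 : ∀ i, lo i ≤ g x i) (h2 : ∀ i, g x i ≤ up i) :
      ∀ᶠ y in 𝓝 x, ∀ i, (lo i = g x i ∨ lo i ≤ g y i) ∧ (g x i = up i ∨ g y i ≤ up i) := by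
    refine eventually_all.2 fun i => ?_
    have hc : ContinuousAt (fun y => g y i) x := (continuous_pi_iff.1 hg i).continuousAt
    refine Eventually.and ?_ ?_
    · rcases (h1 i).eq_or_lt with h | h
      · exact Eventually.of_forall fun _ => Or.inl h
      · exact (hc.eventually_const_le h).mono fun _ => Or.inr
    · rcases (h2 i).eq_or_lt with h | h
      · exact Eventually.of_forall fun _ => Or.inl h
      · exact (hc.eventually_le_const h).mono fun _ => Or.inr
  filter_upwards [key Prod.fst continuous_fst _ _ hx.sgLo_le hx.le_sgUp,
    key (fun y => N.flow y.2) (N.continuous_flow.comp continuous_snd) _ _ hx.pLo_le hx.le_pUp]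
    with y hg hp sl' h0 hb h1 h2 h3 h4
  exact ⟨h0, hb, fun i => (hg i).1.elim (fun h => h1 i h.symm) id,
    fun i => (hg i).2.elim (h2 i) id, fun i => (hp i).1.elim (fun h => h3 i h.symm) id,
    fun i => (hp i).2.elim (h4 i) id⟩

/-- A direction that preserves the equality constraints and does not violate the constraints
binding at a feasible point `x` leads from `x` into the feasible set. -/
theorem Feasible.eventually_add_smul {x d : (Fin NG → ℝ) × (Bus NG NL → ℝ)}
    (hx : N.Feasible ξ sl x) (h0 : d.2 N.slack = 0)
    (hb : Matrix.mulVec (N.C * N.B * N.C.transpose) d.2 = Sum.elim d.1 0)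
    (h1 : ∀ i, x.1 i = ξ.sgLo i → 0 ≤ d.1 i) (h2 : ∀ i, x.1 i = ξ.sgUp i → d.1 i ≤ 0)
    (h3 : ∀ e, N.flow x.2 e = ξ.pLo e → 0 ≤ N.flow d.2 e)
    (h4 : ∀ e, N.flow x.2 e = ξ.pUp e → N.flow d.2 e ≤ 0) :
    ∃ t : ℝ, 0 < t ∧ N.Feasible ξ sl (x + t • d) := by
  have hc : Tendsto (fun t : ℝ => x + t • d) (𝓝[>] 0) (𝓝 x) := by
    have : Continuous fun t : ℝ => x + t • d := by fun_prop
    simpa using (this.tendsto 0).mono_left nhdsWithin_le_nhds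
  obtain ⟨t, ht, htpos⟩ := ((hc.eventually hx.eventually).and self_mem_nhdsWithin).exists
  have htpos : 0 < t := htpos
  refine ⟨t, htpos, ht sl ?_ ?_ ?_ ?_ ?_ ?_⟩
  · simp [hx.slack_zero, h0]
  · simp only [Prod.snd_add, Prod.smul_snd, Matrix.mulVec_add, Matrix.mulVec_smul, hx.balance, hb]
    ext (v | v) <;> simp
  · intro i hi
    have := mul_nonneg htpos.le (h1 i hi)
    simp only [Prod.fst_add, Prod.smul_fst, Pi.add_apply, Pi.smul_apply, smul_eq_mul]
    linarith
  · intro i hi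
    have := mul_nonpos_of_nonneg_of_nonpos htpos.le (h2 i hi)
    simp only [Prod.fst_add, Prod.smul_fst, Pi.add_apply, Pi.smul_apply, smul_eq_mul]
    linarith
  · intro e he
    have := mul_nonneg htpos.le (h3 e he)
    simp only [Prod.snd_add, Prod.smul_snd, flow_add, flow_smul, Pi.add_apply, Pi.smul_apply,
      smul_eq_mul]
    linarith
  · intro e he
    have := mul_nonpos_of_nonneg_of_nonpos htpos.le (h4 e he)
    simp only [Prod.snd_add, Prod.smul_snd, flow_add, flow_smul, Pi.add_apply, Pi.smul_apply,
      smul_eq_mul]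
    linarith

/-- First-order optimality condition at an optimal solution. -/
theorem IsOptimal.dotProduct_nonneg {x d : (Fin NG → ℝ) × (Bus NG NL → ℝ)}
    (hx : N.IsOptimal ξ f sl x) (h0 : d.2 N.slack = 0)
    (hb : Matrix.mulVec (N.C * N.B * N.C.transpose) d.2 = Sum.elim d.1 0)
    (h1 : ∀ i, x.1 i = ξ.sgLo i → 0 ≤ d.1 i) (h2 : ∀ i, x.1 i = ξ.sgUp i → d.1 i ≤ 0)
    (h3 : ∀ e, N.flow x.2 e = ξ.pLo e → 0 ≤ N.flow d.2 e)
    (h4 : ∀ e, N.flow x.2 e = ξ.pUp e → N.flow d.2 e ≤ 0) : 0 ≤ dotProduct f d.1 := by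
  obtain ⟨t, ht, hf⟩ := hx.1.eventually_add_smul h0 hb h1 h2 h3 h4
  have := hx.2 _ hf
  simp only [Prod.fst_add, Prod.smul_fst, dotProduct_add, dotProduct_smul, smul_eq_mul] at this
  exact nonneg_of_mul_nonneg_right (by linarith) ht

/-! ### The linear system of binding constraints -/

variable (N) in
/-- The linear system formed by the equality constraints together with the generators `SG` and the
branches `SB` held fixed. -/
def bindingSystem (SG : Set (Fin NG)) (SB : Set (Fin NE)) :
    ((Fin NG → ℝ) × (Bus NG NL → ℝ)) →ₗ[ℝ] (ℝ × (Bus NG NL → ℝ)) × ((SG → ℝ) × (SB → ℝ)) where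
  toFun d := ((d.2 N.slack,
    Matrix.mulVec (N.C * N.B * N.C.transpose) d.2 - Sum.elim d.1 0),
    (fun i => d.1 i, fun e => N.flow d.2 e))
  map_add' d d' := by
    refine Prod.ext (Prod.ext ?_ ?_) (Prod.ext ?_ ?_)
    · simp
    · simp only [Prod.snd_add, Prod.fst_add, Matrix.mulVec_add]
      ext (v | v) <;> simp; ring
    · ext; simp
    · ext; simp [flow_add]
  map_smul' t d := by
    refine Prod.ext (Prod.ext ?_ ?_) (Prod.ext ?_ ?_)
    · simp
    · simp only [Prod.smul_snd, Prod.smul_fst, Matrix.mulVec_smul]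
      ext (v | v) <;> simp; ring
    · ext; simp
    · ext; simp [flow_smul]

/-- The binding system at a unique optimal solution has trivial kernel. -/
theorem bindingSystem_injective {x : (Fin NG → ℝ) × (Bus NG NL → ℝ)}
    (hx : N.IsOptimal ξ f sl x) (hu : ∀ y, N.IsOptimal ξ f sl y → y = x) :
    Function.Injective (N.bindingSystem {i | x.1 i = ξ.sgLo i ∨ x.1 i = ξ.sgUp i}
      {e | N.flow x.2 e = ξ.pLo e ∨ N.flow x.2 e = ξ.pUp e}) := by
  rw [← LinearMap.ker_eq_bot, LinearMap.ker_eq_bot']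
  intro d hd
  have h0 : d.2 N.slack = 0 := congrArg (fun z => z.1.1) hd
  have hb : Matrix.mulVec (N.C * N.B * N.C.transpose) d.2 = Sum.elim d.1 0 :=
    sub_eq_zero.1 (congrArg (fun z => z.1.2) hd)
  have hg (i) (hi : x.1 i = ξ.sgLo i ∨ x.1 i = ξ.sgUp i) : d.1 i = 0 :=
    congrFun (congrArg (fun z => z.2.1) hd) ⟨i, hi⟩
  have hp (e) (he : N.flow x.2 e = ξ.pLo e ∨ N.flow x.2 e = ξ.pUp e) : N.flow d.2 e = 0 :=
    congrFun (congrArg (fun z => z.2.2) hd) ⟨e, he⟩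
  -- Both `d` and `-d` are admissible; the first-order condition for `-d` bounds the cost of `d`.
  have hm : dotProduct f d.1 ≤ 0 := by
    have := hx.dotProduct_nonneg (d := -d) (by simp [h0])
      (by
        simp only [Prod.snd_neg, Prod.fst_neg, Matrix.mulVec_neg, hb]
        ext (v | v) <;> simp)
      (fun i hi => by simp [hg i (Or.inl hi)]) (fun i hi => by simp [hg i (Or.inr hi)])
      (fun e he => by simp [flow_neg, hp e (Or.inl he)])
      (fun e he => by simp [flow_neg, hp e (Or.inr he)])
    simpa using this
  obtain ⟨t, ht, hf⟩ := hx.1.eventually_add_smul h0 hb (fun i hi => (hg i (Or.inl hi)).ge)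
    (fun i hi => (hg i (Or.inr hi)).le) (fun e he => (hp e (Or.inl he)).ge)
    (fun e he => (hp e (Or.inr he)).le)
  -- The shifted point costs no more than `x`, so it is a second optimum unless `d = 0`.
  have hopt := hu (x + t • d) ⟨hf, fun y hy => by
    refine le_trans ?_ (hx.2 y hy)
    simp only [Prod.fst_add, Prod.smul_fst, dotProduct_add, dotProduct_smul, smul_eq_mul]
    nlinarith⟩
  exact (smul_eq_zero.1 (add_eq_left.1 hopt)).resolve_left ht.ne'

/-- The dimensions agree: the slack equation and the `NG - 1` fixed quantities match the `NG`
generation variables, and the balance equations match the angles. -/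
theorem bindingSystem_surjective {SG : Set (Fin NG)} {SB : Set (Fin NE)}
    (hinj : Function.Injective (N.bindingSystem SG SB)) (hcard : SG.ncard + SB.ncard = NG - 1) :
    Function.Surjective (N.bindingSystem SG SB) := by
  classical
  refine (LinearMap.injective_iff_surjective_of_finrank_eq_finrank ?_).1 hinj
  have hNG := NeZero.pos NG
  simp only [Module.finrank_prod, Module.finrank_fintype_fun_eq_card, Module.finrank_self,
    Fintype.card_sum, Fintype.card_fin]
  rw [← Nat.card_eq_fintype_card, ← Nat.card_eq_fintype_card, Nat.card_coe_set_eq,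
    Nat.card_coe_set_eq]
  omega

end DCNetwork

/-! ### Counting components after deleting bridges -/

namespace SimpleGraph

/-- Deleting `k` bridges from a connected graph leaves at least `k + 1` components. -/
theorem Connected.card_lt_card_connectedComponent_deleteEdges {V : Type*} [Finite V]
    {G : SimpleGraph V} (hG : G.Connected) (S : Finset (Sym2 V))
    (hS : ∀ e ∈ S, e ∈ G.edgeSet ∧ G.IsBridge e) :
    S.card < Nat.card (G.deleteEdges (S : Set (Sym2 V))).ConnectedComponent := by
  classical
  induction S using Finset.induction_on with
  | empty =>
    have := hG.nonempty
    simp only [Finset.card_empty]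
    exact Nat.card_pos
  | insert e S he ih =>
    rw [Finset.card_insert_of_notMem he]
    refine Nat.lt_of_le_of_lt (ih fun e' h => hS e' (Finset.mem_insert_of_mem h)) ?_
    have hle : G.deleteEdges ((insert e S : Finset (Sym2 V)) : Set (Sym2 V)) ≤
        G.deleteEdges (S : Set (Sym2 V)) := deleteEdges_anti (by simp)
    let φ := ConnectedComponent.map (Hom.ofLE hle)
    have hsurj : Function.Surjective φ := by
      intro K
      induction K using ConnectedComponent.ind with
      | h v => exact ⟨connectedComponentMk _ v, rfl⟩
    -- If deleting `e` did not raise the count, `φ` would be injective, so the ends of `e` would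
    -- stay connected without `e`, contradicting that `e` is a bridge of `G`.
    refine lt_of_le_of_ne (Nat.card_le_card_of_surjective φ hsurj) fun hc => ?_
    have hinj : Function.Injective φ :=
      ((Nat.bijective_iff_surjective_and_card φ).2 ⟨hsurj, hc.symm⟩).1
    obtain ⟨heG, hbr⟩ := hS e (Finset.mem_insert_self _ _)
    induction e using Sym2.ind with
    | h u v =>
      rw [isBridge_iff] at hbr
      have hadj : (G.deleteEdges (S : Set (Sym2 V))).Adj u v := by
        rw [deleteEdges_adj]
        exact ⟨heG, he⟩
      have h1 : φ (connectedComponentMk _ u) = φ (connectedComponentMk _ v) :=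
        ConnectedComponent.sound hadj.reachable
      have h2 := ConnectedComponent.exact (hinj h1)
      refine hbr (h2.mono ?_)
      exact deleteEdges_anti (by simp)

end SimpleGraph

/-! ### Power balance on the components of the cut network -/

namespace DCNetwork

open Filter Topology

variable {NG NL NE : ℕ} {N : DCNetwork NG NL NE}

theorem edgeSet_isBridge_of_mem_bridges {e : Fin NE} (he : e ∈ N.bridges) :
    N.graph.IsBridge (N.edge e : Sym2 (Bus NG NL)) := by
  by_contra h
  rw [bridges, Set.mem_ofPred_eq] at he
  rw [N.edge_eq] at h he
  exact he (N.connected.connected_delete_edge_of_not_isBridge h)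

/-- Cutting a set of bridges leaves more components than there are bridges in the set. -/
theorem ncard_lt_card_connectedComponent_cut {SB : Set (Fin NE)} (hSB : SB ⊆ N.bridges) :
    SB.ncard < Nat.card (N.cut SB).ConnectedComponent := by
  classical
  have hfin : ((fun e => (N.edge e : Sym2 (Bus NG NL))) '' SB).Finite := Set.toFinite _
  have := N.connected.card_lt_card_connectedComponent_deleteEdges hfin.toFinset (by
    simp only [Set.Finite.mem_toFinset, Set.forall_mem_image]
    exact fun e he => ⟨(N.edge e).2, edgeSet_isBridge_of_mem_bridges (hSB he)⟩)
  rwa [Set.Finite.coe_toFinset, ← Set.ncard_eq_toFinset_card _ hfin,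
    Set.ncard_image_of_injective _ N.edge_val_injective] at this

theorem reachable_tail_head {SB : Set (Fin NE)} {e : Fin NE} (he : e ∉ SB) :
    (N.cut SB).Reachable (N.tail e) (N.head e) := by
  refine SimpleGraph.Adj.reachable ?_
  rw [cut, SimpleGraph.deleteEdges_adj, ← SimpleGraph.mem_edgeSet, ← N.edge_eq]
  refine ⟨(N.edge e).2, ?_⟩
  rintro ⟨e', he', h⟩
  exact he (N.edge_val_injective h ▸ he')

open Classical in
/-- The net injections in a component of the cut network sum to zero if no power flows on the cut
branches. -/
theorem sum_component_balance_eq_zero {SB : Set (Fin NE)} (K : (N.cut SB).ConnectedComponent)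
    {θ : Bus NG NL → ℝ} (h : ∀ e ∈ SB, N.flow θ e = 0) :
    ∑ v, (if (N.cut SB).connectedComponentMk v = K then (1 : ℝ) else 0) *
      Matrix.mulVec (N.C * N.B * N.C.transpose) θ v = 0 := by
  refine N.sum_mul_balance_eq_zero _ θ fun e => ?_
  by_cases he : e ∈ SB
  · exact Or.inl (h e he)
  · right
    rw [SimpleGraph.ConnectedComponent.sound (reachable_tail_head he)]

open Classical in
/-- In a component with a single free generator, that generator absorbs all load changes. -/
theorem apply_eq_sum_of_balance {SG : Set (Fin NG)} {SB : Set (Fin NE)} {v : Fin NG}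
    (hv : ∀ w, w ∉ SG → (N.cut SB).Reachable (Sum.inl w) (Sum.inl v) → w = v)
    {d : (Fin NG → ℝ) × (Bus NG NL → ℝ)} {h : Fin NL → ℝ}
    (hb : Matrix.mulVec (N.C * N.B * N.C.transpose) d.2 = Sum.elim d.1 (-h))
    (hg : ∀ i ∈ SG, d.1 i = 0) (hp : ∀ e ∈ SB, N.flow d.2 e = 0) :
    d.1 v = ∑ u, if (N.cut SB).Reachable (Sum.inl v) (Sum.inr u) then h u else 0 := by
  have hsum := sum_component_balance_eq_zero ((N.cut SB).connectedComponentMk (Sum.inl v)) hp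
  rw [hb, Fintype.sum_sum_type] at hsum
  simp only [Sum.elim_inl, Sum.elim_inr, Pi.neg_apply, mul_neg, Finset.sum_neg_distrib, ite_mul,
    one_mul, zero_mul, SimpleGraph.ConnectedComponent.eq] at hsum
  -- Only `v` survives among the generators: fixed ones do not change, other free ones lie outside
  -- the component.
  rw [Finset.sum_eq_single v (fun w _ hw => ?_) (by simp), if_pos (.refl _),
    ← sub_eq_add_neg, sub_eq_zero] at hsum
  · simpa only [SimpleGraph.reachable_comm] using hsum
  · by_cases hw' : w ∈ SG
    · rw [hg w hw', ite_self]
    · exact if_neg fun hr => hw (hv w hw' hr)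

variable [NeZero NG] {ξ : Limits NG NE} {f : Fin NG → ℝ} {sl : Fin NL → ℝ}

/-- If the binding system is solvable, every component contains a generator that is not fixed. -/
theorem exists_notMem_of_bindingSystem_surjective {SG : Set (Fin NG)} {SB : Set (Fin NE)}
    (hs : Function.Surjective (N.bindingSystem SG SB)) (K : (N.cut SB).ConnectedComponent) :
    ∃ v ∉ SG, (N.cut SB).connectedComponentMk (Sum.inl v) = K := by
  classical
  by_contra! hK
  induction K using SimpleGraph.ConnectedComponent.ind with
  | h w =>
    -- A unit injection at `w` that no generator of its component can compensate; summing over the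
    -- component gives `1 = 0`.
    obtain ⟨d, hd⟩ := hs ((0, Pi.single w 1), 0)
    have hb : Matrix.mulVec (N.C * N.B * N.C.transpose) d.2 =
        Pi.single w 1 + Sum.elim d.1 0 :=
      sub_eq_iff_eq_add.1 (congrArg (fun z => z.1.2) hd)
    have hg (i) (hi : i ∈ SG) : d.1 i = 0 := congrFun (congrArg (fun z => z.2.1) hd) ⟨i, hi⟩
    have hp (e) (he : e ∈ SB) : N.flow d.2 e = 0 :=
      congrFun (congrArg (fun z => z.2.2) hd) ⟨e, he⟩
    have hsum := sum_component_balance_eq_zero ((N.cut SB).connectedComponentMk w) hp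
    rw [hb] at hsum
    simp only [Pi.add_apply, mul_add, Finset.sum_add_distrib, Fintype.sum_sum_type (fun v => _ *
      Sum.elim d.1 0 v), Sum.elim_inl, Sum.elim_inr, Pi.zero_apply, mul_zero,
      Finset.sum_const_zero, add_zero] at hsum
    rw [Finset.sum_eq_zero (s := (Finset.univ : Finset (Fin NG))), add_zero] at hsum
    · simp [Pi.single_apply] at hsum
    · intro v _
      by_cases hv : v ∈ SG
      · rw [hg v hv, mul_zero]
      · rw [if_neg (hK v hv), zero_mul]

/-- If the binding system is square and solvable and the fixed branches are bridges, every
component contains exactly one generator that is not fixed. -/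
theorem existsUnique_notMem_of_bindingSystem_surjective {SG : Set (Fin NG)} {SB : Set (Fin NE)}
    (hs : Function.Surjective (N.bindingSystem SG SB)) (hcard : SG.ncard + SB.ncard = NG - 1)
    (hSB : SB ⊆ N.bridges) (K : (N.cut SB).ConnectedComponent) :
    ∃! v, v ∉ SG ∧ (N.cut SB).connectedComponentMk (Sum.inl v) = K := by
  let φ : ↥SGᶜ → (N.cut SB).ConnectedComponent := fun v =>
    (N.cut SB).connectedComponentMk (Sum.inl v)
  have hsurj : Function.Surjective φ := fun K =>
    let ⟨v, hv, h⟩ := exists_notMem_of_bindingSystem_surjective hs K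
    ⟨⟨v, hv⟩, h⟩
  have hbij : Function.Bijective φ := by
    refine (Nat.bijective_iff_surjective_and_card φ).2
      ⟨hsurj, le_antisymm ?_ (Nat.card_le_card_of_surjective φ hsurj)⟩
    -- The free generators number `NG - SG.ncard = SB.ncard + 1`, at most the number of components.
    have h1 := Set.ncard_add_ncard_compl SG
    have h2 := ncard_lt_card_connectedComponent_cut hSB
    have h3 := NeZero.pos NG
    rw [Nat.card_coe_set_eq]
    rw [Nat.card_eq_fintype_card, Fintype.card_fin] at h1
    omega
  obtain ⟨⟨v, hv⟩, h⟩ := hsurj K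
  exact ⟨v, ⟨hv, h⟩, fun w hw => congrArg Subtype.val
    (hbij.1 (a₁ := ⟨w, hw.1⟩) (a₂ := ⟨v, hv⟩) (hw.2.trans h.symm))⟩

/-! ### Local affine response of the optimum -/

theorem isOptimal_sol (hf : f ∈ N.OmegaF ξ) (hsl : sl ∈ N.OmegaL ξ) :
    N.IsOptimal ξ f sl (N.sol ξ f sl) := by
  have h := (hf sl hsl).1.exists
  rw [sol, dif_pos h]
  exact h.choose_spec

/-- Each inequality constraint binds at one of its two limits at most. -/
theorem ncard_bindingGens_add_ncard_bindingBranches :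
    (N.bindingGens ξ f sl).ncard + (N.bindingBranches ξ f sl).ncard = N.numBinding ξ f sl := by
  rw [numBinding, bindingGens, bindingBranches, Set.ofPred_or, Set.ofPred_or,
    Set.ncard_union_eq, Set.ncard_union_eq, add_assoc, add_assoc, add_assoc]
  · exact Set.disjoint_left.2 fun e h1 h2 => (ξ.pLo_lt_pUp e).ne (h1.symm.trans h2)
  · exact Set.disjoint_left.2 fun i h1 h2 => (ξ.sgLo_lt_sgUp i).ne (h1.symm.trans h2)

theorem bindingSystem_surjective_of_mem_OmegaLTilde (hf : f ∈ N.OmegaF ξ)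
    (hsl : sl ∈ N.OmegaLTilde ξ f) :
    Function.Surjective
      (N.bindingSystem (N.bindingGens ξ f sl) (N.bindingBranches ξ f sl)) := by
  have hopt := isOptimal_sol hf hsl.1
  exact bindingSystem_surjective
    (bindingSystem_injective hopt fun y hy => (hf sl hsl.1).1.unique hy hopt)
    (ncard_bindingGens_add_ncard_bindingBranches.trans hsl.2)

/-- Near `sl` the optimal solution moves linearly, with the binding constraints kept fixed. -/
theorem exists_linearMap_isOptimal (hf : f ∈ N.OmegaF ξ) (hsl : sl ∈ N.OmegaLTilde ξ f) :
    ∃ D : (Fin NL → ℝ) →ₗ[ℝ] (Fin NG → ℝ) × (Bus NG NL → ℝ),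
      (∀ h, Matrix.mulVec (N.C * N.B * N.C.transpose) (D h).2 = Sum.elim (D h).1 (-h)) ∧
      (∀ h, ∀ i ∈ N.bindingGens ξ f sl, (D h).1 i = 0) ∧
      (∀ h, ∀ e ∈ N.bindingBranches ξ f sl, N.flow (D h).2 e = 0) ∧
      ∀ᶠ sl' in 𝓝 sl, sl' ∈ N.OmegaL ξ ∧
        N.IsOptimal ξ f sl' (N.sol ξ f sl + D (sl' - sl)) := by
  obtain ⟨R, hR⟩ := LinearMap.exists_rightInverse_of_surjective _
    (LinearMap.range_eq_top.2 (bindingSystem_surjective_of_mem_OmegaLTilde hf hsl))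
  -- The right-hand side for a load change `h`: slack angle and binding quantities stay put, and
  -- only the load balances shift.
  let J : (Fin NL → ℝ) →ₗ[ℝ] (ℝ × (Bus NG NL → ℝ)) ×
      ((N.bindingGens ξ f sl → ℝ) × (N.bindingBranches ξ f sl → ℝ)) :=
    { toFun := fun h => ((0, Sum.elim 0 (-h)), 0)
      map_add' := fun h h' => by
        refine Prod.ext (Prod.ext (by simp) ?_) (by simp)
        ext (v | v) <;> simp [add_comm]
      map_smul' := fun t h => by
        refine Prod.ext (Prod.ext (by simp) ?_) (by simp)
        ext (v | v) <;> simp }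
  let D := R ∘ₗ J
  have hD (h) : N.bindingSystem _ _ (D h) = J h := LinearMap.congr_fun hR (J h)
  have h0 (h) : (D h).2 N.slack = 0 := congrArg (fun z => z.1.1) (hD h)
  have hb (h) : Matrix.mulVec (N.C * N.B * N.C.transpose) (D h).2 = Sum.elim (D h).1 (-h) := by
    rw [sub_eq_iff_eq_add.1 (congrArg (fun z => z.1.2) (hD h))]
    ext (v | v) <;> simp [J]
  have hg (h) : ∀ i ∈ N.bindingGens ξ f sl, (D h).1 i = 0 := fun i hi =>
    congrFun (congrArg (fun z => z.2.1) (hD h)) ⟨i, hi⟩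
  have hp (h) : ∀ e ∈ N.bindingBranches ξ f sl, N.flow (D h).2 e = 0 := fun e he =>
    congrFun (congrArg (fun z => z.2.2) (hD h)) ⟨e, he⟩
  refine ⟨D, hb, hg, hp, ?_⟩
  have hopt := isOptimal_sol hf hsl.1
  set x := N.sol ξ f sl with hx
  have hgx (h i) (hi : x.1 i = ξ.sgLo i ∨ x.1 i = ξ.sgUp i) : (x + D h).1 i = x.1 i := by
    simp [hg h i hi]
  have hpx (h e) (he : N.flow x.2 e = ξ.pLo e ∨ N.flow x.2 e = ξ.pUp e) :
      N.flow (x + D h).2 e = N.flow x.2 e := by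
    simp [flow_add, hp h e he]
  have hcont : Tendsto (fun sl' => x + D (sl' - sl)) (𝓝 sl) (𝓝 x) := by
    have hDc : Continuous D := D.continuous_of_finiteDimensional
    have : Continuous fun sl' => x + D (sl' - sl) := by fun_prop
    simpa using this.tendsto sl
  have hpos : ∀ᶠ sl' in 𝓝 sl, ∀ j, 0 < sl' j := eventually_all.2 fun j =>
    (continuous_apply j).continuousAt.eventually_const_lt (hsl.1.1 j)
  filter_upwards [hcont.eventually hopt.1.eventually, hpos] with sl' hfeas hpos
  have hfeas : N.Feasible ξ sl' (x + D (sl' - sl)) := by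
    refine hfeas sl' ?_ ?_ (fun i hi => ?_) (fun i hi => ?_) (fun e he => ?_) (fun e he => ?_)
    · simp [hopt.1.slack_zero, h0]
    · rw [Prod.snd_add, Matrix.mulVec_add, hopt.1.balance, hb]
      ext (v | v)
      · simp
      · simp only [Pi.add_apply, Sum.elim_inr, Pi.neg_apply, Pi.sub_apply]
        ring
    · exact (hi.symm.trans (hgx _ i (Or.inl hi)).symm).le
    · exact ((hgx _ i (Or.inr hi)).trans hi).le
    · exact (he.symm.trans (hpx _ e (Or.inl he)).symm).le
    · exact ((hpx _ e (Or.inr he)).trans he).le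
  refine ⟨⟨hpos, _, hfeas⟩, hfeas, fun y hy => ?_⟩
  -- Both ends of this direction serve `sl'`, so the loads cancel; the moved point sits on every
  -- limit binding at `x`, so the direction is admissible at the old optimum `x`.
  have := hopt.dotProduct_nonneg (d := y - (x + D (sl' - sl))) ?_ ?_ (fun i hi => ?_)
    (fun i hi => ?_) (fun e he => ?_) (fun e he => ?_)
  · rwa [Prod.fst_sub, dotProduct_sub, sub_nonneg] at this
  · rw [Prod.snd_sub, Pi.sub_apply, hy.slack_zero, hfeas.slack_zero, sub_zero]
  · rw [Prod.snd_sub, Matrix.mulVec_sub, hy.balance, hfeas.balance]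
    ext (v | v) <;> simp
  · rw [Prod.fst_sub, Pi.sub_apply, hgx _ i (Or.inl hi), hi, sub_nonneg]
    exact hy.sgLo_le i
  · rw [Prod.fst_sub, Pi.sub_apply, hgx _ i (Or.inr hi), hi, sub_nonpos]
    exact hy.le_sgUp i
  · rw [Prod.snd_sub, flow_sub, Pi.sub_apply, hpx _ e (Or.inl he), he, sub_nonneg]
    exact hy.pLo_le e
  · rw [Prod.snd_sub, flow_sub, Pi.sub_apply, hpx _ e (Or.inr he), he, sub_nonpos]
    exact hy.le_pUp e

end DCNetwork

/-! ### Derivative, monotonicity and component structure -/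

theorem mainTheorem2 {NG NL NE : ℕ} [NeZero NG] (N : DCNetwork NG NL NE)
    (ξ : Limits NG NE) (hξ : ξ ∈ N.Omega)
    (f : Fin NG → ℝ) (hf : f ∈ N.OmegaF ξ)
    (sl : Fin NL → ℝ) (hsl : sl ∈ N.OmegaLTilde ξ f)
    (hbridge : N.bindingBranches ξ f sl ⊆ N.bridges) :
    -- the derivative exists and is entrywise nonnegative
    DifferentiableAt ℝ (N.OPF ξ f) sl ∧
    (∀ v u, 0 ≤ N.jacobian ξ f sl v u) ∧
    -- the OPF operator is monotone near `sl`
    (∃ U ∈ nhds sl, U ⊆ N.OmegaL ξ ∧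
      ∀ α ∈ U, ∀ β ∈ U, β ≤ α → N.OPF ξ f β ≤ N.OPF ξ f α) ∧
    -- each component left after cutting the binding bridges has exactly one unsaturated generator
    (∀ K : (N.cut (N.bindingBranches ξ f sl)).ConnectedComponent,
      ∃! v : Fin NG, v ∉ N.bindingGens ξ f sl ∧
        (N.cut (N.bindingBranches ξ f sl)).connectedComponentMk (Sum.inl v) = K) ∧
    -- that generator absorbs the load changes in its component; nothing else changes
    (∀ v u,
      (v ∉ N.bindingGens ξ f sl ∧
          (N.cut (N.bindingBranches ξ f sl)).Reachable (Sum.inl v) (Sum.inr u) →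
        N.jacobian ξ f sl v u = 1) ∧
      (¬ (v ∉ N.bindingGens ξ f sl ∧
          (N.cut (N.bindingBranches ξ f sl)).Reachable (Sum.inl v) (Sum.inr u)) →
        N.jacobian ξ f sl v u = 0)) := by
  classical
  have hcomp := DCNetwork.existsUnique_notMem_of_bindingSystem_surjective
    (DCNetwork.bindingSystem_surjective_of_mem_OmegaLTilde hf hsl)
    (DCNetwork.ncard_bindingGens_add_ncard_bindingBranches.trans hsl.2) hbridge
  obtain ⟨D, hb, hg, hp, hD⟩ := DCNetwork.exists_linearMap_isOptimal hf hsl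
  -- the closed form of the linear response of the generators
  have hform (h v) : (D h).1 v = ∑ u, if v ∉ N.bindingGens ξ f sl ∧
      (N.cut (N.bindingBranches ξ f sl)).Reachable (Sum.inl v) (Sum.inr u) then h u else 0 := by
    by_cases hv : v ∈ N.bindingGens ξ f sl
    · simp [hv, hg h v hv]
    · simpa only [hv, not_false_eq_true, true_and] using
        DCNetwork.apply_eq_sum_of_balance
          (fun w hw hr => (hcomp _).unique ⟨hw, SimpleGraph.ConnectedComponent.sound hr⟩ ⟨hv, rfl⟩)
          (hb h) (hg h) (hp h)
  have hOPF : ∀ᶠ sl' in nhds sl, sl' ∈ N.OmegaL ξ ∧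
      N.OPF ξ f sl' = N.OPF ξ f sl + (D (sl' - sl)).1 := by
    filter_upwards [hD] with sl' h
    exact ⟨h.1, congrArg Prod.fst
      ((hf sl' h.1).1.unique (DCNetwork.isOptimal_sol hf h.1) h.2)⟩
  let L : (Fin NL → ℝ) →L[ℝ] (Fin NG → ℝ) :=
    LinearMap.toContinuousLinearMap (LinearMap.fst ℝ _ _ ∘ₗ D)
  have hderiv : HasFDerivAt (N.OPF ξ f) L sl := by
    refine HasFDerivAt.congr_of_eventuallyEq ?_ (hOPF.mono fun _ h => h.2)
    exact (L.hasFDerivAt.comp sl ((hasFDerivAt_id sl).sub_const sl)).const_add _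
  have hjac (v u) : N.jacobian ξ f sl v u = if v ∉ N.bindingGens ξ f sl ∧
      (N.cut (N.bindingBranches ξ f sl)).Reachable (Sum.inl v) (Sum.inr u) then 1 else 0 := by
    rw [DCNetwork.jacobian, Matrix.of_apply, hderiv.fderiv]
    refine (hform _ v).trans ?_
    rw [Finset.sum_eq_single u (fun w _ hw => by simp [hw]) (by simp), Pi.single_eq_same]
  refine ⟨hderiv.differentiableAt, fun v u => ?_, ⟨_, hOPF, fun _ h => h.1, ?_⟩, hcomp,
    fun v u => ⟨fun h => ?_, fun h => ?_⟩⟩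
  · rw [hjac]
    split_ifs <;> norm_num
  -- The affine formula based at `sl` holds at both points, so the 0-1 weighted sums are compared
  -- term by term.
  · intro α hα β hβ hle v
    rw [hα.2, hβ.2, Pi.add_apply, Pi.add_apply, hform, hform]
    gcongr with u
    split_ifs
    · exact sub_le_sub_right (hle u) _
    · exact le_rfl
  · rw [hjac, if_pos h]
  · rw [hjac, if_neg h]
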